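/- **Setting.** Let $n,k\ge 1$ be integers. A configuration of $n$ nodes with colors $1,\dots,k$ is a vector $c\in\mathbb N_0^k$ with $\sum_i c_i=n$, where $c_i$ is the number of nodes with color $i$; let $\mathcal C$ be the set of configurations. For $x,y\in\mathbb R^k$ write $x\succeq y$ ($x$ majorizes $y$) if for every $l\le k$ the sum of the $l$ largest components of $x$ is at least the sum of the $l$ largest components of $y$, and $\sum_i x_i=\sum_i y_i$. An anonymous aggregation (AC) process $P_\alpha$ is given by a function $\alpha$ that maps each $c\in\mathcal C$ to a probability vector $\alpha(c)=(\alpha_1(c),\dots,\alpha_k(c))$: in each synchronous round, if the current configuration is $c$, every node adopts, independently of the other nodes and of the past, color $i$ with probability $\alpha_i(c)$. Thus the successive configurations form a Markov chain on $\mathcal C$. Let $P(c)$ be the random configuration after one round of $P$ from $c$. A process $P$ dominates a process $P'$ if $\mathbb E[P(c)]\succeq\mathbb E[P'(c')]$ for all $c,c'\in\mathcal C$ with $c\succeq c'$. (For AC processes $\mathbb E[P_\alpha(c)]=n\,\alpha(c)$, so this says that $c\succeq c'$ implies $\alpha(c)\succeq\alpha'(c')$.) For $\kappa\in\mathbb N$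 let $T_P^\kappa(c)\in\mathbb N_0\cup\{\infty\}$ be the first time $t\ge 0$ at which the configuration of $P$, started from $c$ at time $0$, has at most $\kappa$ colors with non-zero support ($\infty$ if there is no such time). **Theorem.** Let $P$ and $P'$ be two AC processes with process functions $\alpha$ and $\alpha'$ such that $P$ dominates $P'$, and let both be started from the same configuration $c\in\mathcal C$. Then for every $\kappa\in\mathbb N$ the time $T_{P'}^\kappa(c)$ stochastically dominates $T_P^\kappa(c)$, that is, $$\Pr\bigl[T_P^\kappa(c)\ge x\bigr]\le\Pr\bigl[T_{P'}^\kappa(c)\ge x\bigr]\qquad\text{for all }x\in\mathbb N_0 .$$ -/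

import Mathlib

open MeasureTheory ProbabilityTheory

namespace ACConsensus

/-- The components of `x` in non-increasing order. -/
noncomputable def sortDown {d : ℕ} (x : Fin d → ℝ) : Fin d → ℝ :=
  x ∘ Tuple.sort (fun i => -x i)

/-- `Majorizes x y` is vector majorization `x ⪰ y`: each partial sum of the non-increasing
rearrangement of `x` is at least the one of `y`, and the total sums agree. -/
def Majorizes {d : ℕ} (x y : Fin d → ℝ) : Prop :=
  (∀ l : Fin d, ∑ i ∈ Finset.Iic l, sortDown y i ≤ ∑ i ∈ Finset.Iic l, sortDown x i) ∧
    ∑ i, x i = ∑ i, y i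

/-- Configurations of `n` nodes with colors from a set of size `k`; `c i` is the number of
nodes that support color `i`. -/
abbrev Config (n k : ℕ) : Type := {c : Fin k → ℕ // ∑ i, c i = n}

/-- A configuration as a real vector. -/
def Config.toReal {n k : ℕ} (c : Config n k) : Fin k → ℝ := fun i => (c.1 i : ℝ)

/-- The number of remaining colors, i.e. of colors with at least one supporter. -/
def Config.numColors {n k : ℕ} (c : Config n k) : ℕ :=
  (Finset.univ.filter fun i => c.1 i ≠ 0).card

/-- The configuration that results when node `v` has color `x v`. -/
def Config.ofColoring {n k : ℕ} (x : Fin n → Fin k) : Config n k :=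
  ⟨fun i => (Finset.univ.filter fun v => x v = i).card, by
    have h := Finset.card_eq_sum_card_fiberwise (f := x) (s := Finset.univ)
      (t := Finset.univ) (fun _ _ => Finset.mem_coe.2 (Finset.mem_univ _))
    rw [Finset.card_univ, Fintype.card_fin] at h
    exact h.symm⟩

/-- An anonymous aggregation process, given by its process function `α`, which maps each
configuration `c` to a probability vector `α c` on the colors. -/
structure ACProcess (n k : ℕ) where
  /-- The process function. -/
  α : Config n k → Fin k → ℝ
  nonneg : ∀ c i, 0 ≤ α c i
  sum_eq_one : ∀ c, ∑ i, α c i = 1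

namespace ACProcess

variable {n k : ℕ}

/-- The law of the color that a single node adopts in configuration `c`. -/
noncomputable def nodeLaw (P : ACProcess n k) (c : Config n k) : Measure (Fin k) :=
  ∑ i, ENNReal.ofReal (P.α c i) • Measure.dirac i

/-- The law of `P(c)`, the configuration after one step from `c`: all nodes independently adopt
a color according to `nodeLaw`. -/
noncomputable def stepLaw (P : ACProcess n k) (c : Config n k) : Measure (Config n k) :=
  (Measure.pi fun _ : Fin n => P.nodeLaw c).map Config.ofColoring

/-- The expected configuration `𝔼[P(c)]` after one step from `c`. -/
noncomputable def expectedStep (P : ACProcess n k) (c : Config n k) : Fin k → ℝ :=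
  fun i => ∫ d, d.toReal i ∂(P.stepLaw c)

/-- Protocol dominance: `c ⪰ c'` implies `𝔼[P(c)] ⪰ 𝔼[P'(c')]`. -/
def Dominates (P P' : ACProcess n k) : Prop :=
  ∀ c c' : Config n k, Majorizes c.toReal c'.toReal →
    Majorizes (P.expectedStep c) (P'.expectedStep c')

/-- `X` is a run of `P` started in `c`: a Markov chain with initial state `c` whose next
configuration, given the history up to time `t`, has law `P.stepLaw (X t)`. -/
structure IsRun (P : ACProcess n k) (c : Config n k) {Ω : Type*} [MeasurableSpace Ω]
    (μ : Measure Ω) (X : ℕ → Ω → Config n k) : Prop where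
  measurable : ∀ t, Measurable (X t)
  init : ∀ᵐ ω ∂μ, X 0 ω = c
  markov : ∀ (t : ℕ) (x : ℕ → Config n k),
    μ {ω | ∀ s ≤ t + 1, X s ω = x s} =
      μ {ω | ∀ s ≤ t, X s ω = x s} * P.stepLaw (x t) {x (t + 1)}

end ACProcess

/-- The first time at which at most `κ` colors remain; it is `⊤` if there is no such time. -/
noncomputable def reductionTime {n k : ℕ} {Ω : Type*} (X : ℕ → Ω → Config n k) (κ : ℕ)
    (ω : Ω) : ℕ∞ :=
  ⨅ (t : ℕ) (_ : (X t ω).numColors ≤ κ), (t : ℕ∞)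

/-- Stochastic dominance `S ≤ˢᵗ T` for random variables `S`, `T` with values in `ℕ ∪ {∞}`, possibly
on different probability spaces: `Pr[S ≥ x] ≤ Pr[T ≥ x]` for every natural number `x`. -/
def StochLE {Ω Ω' : Type*} [MeasurableSpace Ω] [MeasurableSpace Ω'] (μ : Measure Ω)
    (S : Ω → ℕ∞) (μ' : Measure Ω') (T : Ω' → ℕ∞) : Prop :=
  ∀ x : ℕ, μ {ω | (x : ℕ∞) ≤ S ω} ≤ μ' {ω | (x : ℕ∞) ≤ T ω}

end ACConsensus

namespace ACConsensus.ACProcess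

section Sanity
open Finset Preorder
variable {n k : ℕ}

instance (P : ACProcess n k) (c : Config n k) : IsProbabilityMeasure (P.nodeLaw c) := by
  constructor
  simp only [nodeLaw, Measure.coe_finsetSum, Finset.sum_apply, Measure.smul_apply, measure_univ,
    smul_eq_mul, mul_one]
  rw [← ENNReal.ofReal_sum_of_nonneg fun i _ => P.nonneg c i, P.sum_eq_one, ENNReal.ofReal_one]

instance (P : ACProcess n k) (c : Config n k) : IsProbabilityMeasure (P.stepLaw c) :=
  Measure.isProbabilityMeasure_map (measurable_of_countable _).aemeasurable

/-- Every process has a run from every configuration. -/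
theorem exists_run (P : ACProcess n k) (c : Config n k) :
    ∃ μ : Measure (ℕ → Config n k), IsProbabilityMeasure μ ∧ P.IsRun c μ fun t ω => ω t := by
  let K : (t : ℕ) → Kernel ((i : Iic t) → Config n k) (Config n k) := fun t =>
    Kernel.ofFunOfCountable fun h => P.stepLaw (h ⟨t, mem_Iic.2 le_rfl⟩)
  have : ∀ t, IsMarkovKernel (K t) := fun t =>
    ⟨fun h => inferInstanceAs (IsProbabilityMeasure (P.stepLaw (h ⟨t, mem_Iic.2 le_rfl⟩)))⟩
  have hr : ∀ t (h : (i : Iic t) → Config n k),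
      ∀ᵐ ω ∂(Kernel.traj (X := fun _ => Config n k) K t h), frestrictLe t ω = h := by
    intro t h
    have h1 := Kernel.traj_map_frestrictLe_apply (X := fun _ => Config n k) (κ := K) t t h
    rw [Kernel.partialTraj_self, Kernel.id_apply] at h1
    have h2 : ∀ᵐ y ∂((Kernel.traj (X := fun _ => Config n k) K t h).map (frestrictLe t)),
        y = h := by
      rw [h1]; simp [ae_dirac_eq]
    exact ae_of_ae_map (measurable_frestrictLe t).aemeasurable h2
  have he : ∀ (t : ℕ) (x ω : ℕ → Config n k), (∀ s ≤ t, ω s = x s) ↔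
      (frestrictLe (π := fun _ => Config n k) t ω = frestrictLe (π := fun _ => Config n k) t x) := by
    intro t x ω
    simp [funext_iff]
  refine ⟨Kernel.traj (X := fun _ => Config n k) K 0 (fun _ => c), inferInstance,
    fun t => measurable_pi_apply t, ?_, ?_⟩
  · filter_upwards [hr 0 fun _ => c] with ω hω
    exact congrFun hω ⟨0, by simp⟩
  · intro t x
    have hm : ∀ t, MeasurableSet {ω : ℕ → Config n k | ∀ s ≤ t, ω s = x s} := by
      intro t
      have : {ω : ℕ → Config n k | ∀ s ≤ t, ω s = x s} =
          frestrictLe (π := fun _ => Config n k) t ⁻¹' {frestrictLe (π := fun _ => Config n k) t x} := by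
        ext ω; exact he t x ω
      rw [this]
      exact measurable_frestrictLe t (measurableSet_singleton _)
    rw [← Kernel.traj_comp_partialTraj (X := fun _ => Config n k) (κ := K) (Nat.zero_le t),
      Kernel.comp_apply' _ _ _ (hm _), Kernel.comp_apply' _ _ _ (hm _),
      ← lintegral_mul_const _ (Kernel.measurable_coe _ (hm _))]
    refine lintegral_congr fun h => ?_
    by_cases hx : h = frestrictLe (π := fun _ => Config n k) t x
    · subst hx
      have h1 : Kernel.traj (X := fun _ => Config n k) K t (frestrictLe t x)
          {ω | ∀ s ≤ t, ω s = x s} = 1 := by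
        rw [prob_compl_eq_zero_iff (hm t) |>.symm]
        filter_upwards [hr t (frestrictLe t x)] with ω hω
        exact (he t x ω).2 hω
      rw [h1, one_mul]
      have h2 := congrArg (fun κ => κ (frestrictLe (π := fun _ => Config n k) t x) {x (t+1)})
        (Kernel.map_traj_succ_self (X := fun _ => Config n k) (κ := K) (a := t))
      rw [Kernel.map_apply' _ (measurable_pi_apply _) _ (measurableSet_singleton _)] at h2
      refine Eq.trans ?_ h2
      refine measure_congr ?_
      filter_upwards [hr t (frestrictLe t x)] with ω hω
      have := (he t x ω).2 hω
      refine propext ⟨fun hh => hh (t+1) le_rfl, fun hh s hs => ?_⟩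
      rcases Nat.lt_or_ge t s with h3 | h3
      · obtain rfl : s = t + 1 := by omega
        exact hh
      · exact this s h3
    · have h0 : ∀ t', t ≤ t' → Kernel.traj (X := fun _ => Config n k) K t h
          {ω | ∀ s ≤ t', ω s = x s} = 0 := by
        intro t' ht'
        rw [measure_eq_zero_iff_ae_notMem]
        filter_upwards [hr t h] with ω hω hh
        exact hx (hω.symm.trans ((he t x ω).1 fun s hs => hh s (hs.trans ht')))
      rw [h0 _ (Nat.le_succ t), h0 _ le_rfl, zero_mul]

/-- `𝔼[P(c)] = n • α(c)`. -/
theorem expectedStep_eq (P : ACProcess n k) (c : Config n k) (i : Fin k) :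
    P.expectedStep c i = n * P.α c i := by
  have hn : ∀ i, (P.nodeLaw c).real {i} = P.α c i := by
    intro i
    simp [nodeLaw, Measure.real, Measure.coe_finsetSum, Finset.sum_apply, Set.indicator,
      P.nonneg]
  have hm : Measurable (Config.ofColoring : (Fin n → Fin k) → Config n k) :=
    measurable_of_countable _
  unfold expectedStep stepLaw
  rw [integral_map hm.aemeasurable (measurable_of_countable _).aestronglyMeasurable]
  have : ∀ x : Fin n → Fin k, (Config.ofColoring x).toReal i
      = ∑ v, Set.indicator {i} (fun _ => (1:ℝ)) (x v) := by
    intro x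
    simp only [Config.ofColoring, Config.toReal, Set.indicator, Set.mem_singleton_iff]
    rw [Finset.card_filter]; push_cast; rfl
  simp_rw [this]
  rw [integral_finsetSum _ fun v _ => Integrable.of_finite]
  have h2 : ∀ v : Fin n, ∫ x : Fin n → Fin k, Set.indicator {i} (fun _ => (1:ℝ)) (x v)
      ∂(Measure.pi fun _ => P.nodeLaw c) = P.α c i := by
    intro v
    have h3 := integral_map (μ := Measure.pi fun _ : Fin n => P.nodeLaw c)
      (φ := fun x => x v) (measurable_pi_apply v).aemeasurable
      (f := Set.indicator {i} (fun _ => (1:ℝ))) (measurable_of_countable _).aestronglyMeasurable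
    rw [← h3, (measurePreserving_eval (fun _ : Fin n => P.nodeLaw c) v).map_eq]
    rw [integral_indicator_const _ (measurableSet_singleton _), hn]; simp
  rw [Finset.sum_congr rfl fun v _ => h2 v]; simp

end Sanity

end ACConsensus.ACProcess

namespace ACConsensus

/-! ### Majorization: subset form, unit transfers, Abel summation -/

section Majorization

variable {d : ℕ}

/-! The heart is Rinott's theorem, `SchurConvex.multinomialMean_le`: the multinomial mean of a
Schur-convex function is Schur convex in the probability vector. It is proved by differentiating
along the segment between the two sorted vectors. Exchanging two colors shows that moving one node
to a likelier color cannot lower the mean (`SchurConvex.sum_prod_erase_le`), and Abel summation then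
makes the derivative nonnegative.

The probability of surviving `m` rounds satisfies a one-step recursion, and
`ACProcess.Dominates.survivalProb_le` compares the processes by induction on `m`, for all pairs of
starts related by majorization. `P` need not dominate itself, so its survival probability need not
be monotone; a monotone envelope is inserted between the two processes, and Rinott's theorem is
applied to that. Finally, the Markov property identifies the recursion with the tail of
`reductionTime`. -/

theorem sortDown_antitone (x : Fin d → ℝ) : Antitone (sortDown x) := by
  intro i j hij
  have := Tuple.monotone_sort (fun i => -x i) hij
  simpa [sortDown] using this

theorem sum_sortDown (x : Fin d → ℝ) : ∑ i, sortDown x i = ∑ i, x i :=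
  Equiv.sum_comp (Tuple.sort fun i => -x i) x

theorem sum_le_sum_Iic_of_antitone {g : Fin d → ℝ} (hg : Antitone g) (l : Fin d)
    (S : Finset (Fin d)) (hS : S.card = l + 1) : ∑ i ∈ S, g i ≤ ∑ i ∈ Finset.Iic l, g i := by
  have h : ∑ i ∈ S, (g i - g l) ≤ ∑ i ∈ Finset.Iic l, (g i - g l) := by
    rw [← Finset.sum_filter_add_sum_filter_not S (fun i => i ≤ l)]
    have h1 : ∑ i ∈ S with ¬ i ≤ l, (g i - g l) ≤ 0 :=
      Finset.sum_nonpos fun i hi => by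
        have := hg (not_le.1 (Finset.mem_filter.1 hi).2).le
        linarith
    have h2 : ∑ i ∈ S with i ≤ l, (g i - g l) ≤ ∑ i ∈ Finset.Iic l, (g i - g l) :=
      Finset.sum_le_sum_of_subset_of_nonneg
        (fun i hi => Finset.mem_Iic.2 (Finset.mem_filter.1 hi).2)
        fun i hi _ => sub_nonneg.2 (hg (Finset.mem_Iic.1 hi))
    linarith
  simp only [Finset.sum_sub_distrib, Finset.sum_const, hS, Fin.card_Iic] at h
  linarith

theorem sum_le_sum_sortDown (x : Fin d → ℝ) (l : Fin d) (S : Finset (Fin d))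
    (hS : S.card = l + 1) : ∑ i ∈ S, x i ≤ ∑ i ∈ Finset.Iic l, sortDown x i := by
  have h := sum_le_sum_Iic_of_antitone (sortDown_antitone x) l
    (S.map (Tuple.sort fun i => -x i).symm.toEmbedding) (by simpa using hS)
  simpa [sortDown] using h

theorem exists_sum_eq_sum_sortDown (x : Fin d → ℝ) (l : Fin d) :
    ∃ S : Finset (Fin d), S.card = l + 1 ∧ ∑ i ∈ S, x i = ∑ i ∈ Finset.Iic l, sortDown x i :=
  ⟨(Finset.Iic l).map (Tuple.sort fun i => -x i).toEmbedding, by simp, by simp [sortDown]⟩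

/-- The `l` largest entries maximize the sum over all `l`-element sets, so sorting can be traded for
a choice of subsets. -/
theorem majorizes_iff (x y : Fin d → ℝ) : Majorizes x y ↔
    (∀ S : Finset (Fin d), ∃ T : Finset (Fin d), T.card = S.card ∧ ∑ i ∈ S, y i ≤ ∑ i ∈ T, x i) ∧
      ∑ i, x i = ∑ i, y i := by
  refine and_congr_left fun _ => ⟨fun h S => ?_, fun h l => ?_⟩
  · rcases hm : S.card with _ | m
    · exact ⟨∅, by simp, by simp [Finset.card_eq_zero.1 hm]⟩
    · have hd : m < d := by
        have := S.card_le_univ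
        rw [Fintype.card_fin] at this
        omega
      obtain ⟨T, hT, hT'⟩ := exists_sum_eq_sum_sortDown x ⟨m, hd⟩
      exact ⟨T, hT, (sum_le_sum_sortDown y ⟨m, hd⟩ S hm).trans ((h _).trans hT'.ge)⟩
  · obtain ⟨S, hS, hS'⟩ := exists_sum_eq_sum_sortDown y l
    obtain ⟨T, hT, hT'⟩ := h S
    rw [← hS']
    exact hT'.trans (sum_le_sum_sortDown x l T (hT.trans hS))

theorem Majorizes.refl (x : Fin d → ℝ) : Majorizes x x := ⟨fun _ => le_rfl, rfl⟩

theorem Majorizes.trans {x y z : Fin d → ℝ} (h : Majorizes x y) (h' : Majorizes y z) :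
    Majorizes x z := ⟨fun l => (h'.1 l).trans (h.1 l), h.2.trans h'.2⟩

theorem Majorizes.of_mul_left {x y : Fin d → ℝ} {a : ℝ} (ha : 0 < a)
    (h : Majorizes (fun i => a * x i) (fun i => a * y i)) : Majorizes x y := by
  rw [majorizes_iff] at h ⊢
  simp only [← Finset.mul_sum, mul_le_mul_iff_right₀ ha, mul_right_inj' ha.ne'] at h
  exact h

theorem majorizes_comp_perm (x : Fin d → ℝ) (σ : Equiv.Perm (Fin d)) :
    Majorizes x (x ∘ σ) := by
  rw [majorizes_iff]
  exact ⟨fun S => ⟨S.map σ.toEmbedding, by simp, by simp⟩, (Equiv.sum_comp σ x).symm⟩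

theorem majorizes_add_single (y : Fin d → ℝ) {i j : Fin d} (h : y j ≤ y i) :
    Majorizes (y + Pi.single i 1) (y + Pi.single j 1) := by
  rw [majorizes_iff]
  refine ⟨fun S => ?_, by simp [Finset.sum_add_distrib]⟩
  -- Only a set that collects the unit at `j` and misses the one at `i` needs changing: exchange `j`
  -- for `i`.
  by_cases hj : j ∈ S ∧ i ∉ S
  · have hi : i ∉ S.erase j := fun hi => hj.2 (Finset.mem_of_mem_erase hi)
    refine ⟨insert i (S.erase j), ?_, ?_⟩
    · rw [Finset.card_insert_of_notMem hi, Finset.card_erase_add_one hj.1]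
    · rw [Finset.sum_insert hi, ← Finset.add_sum_erase S _ hj.1]
      have : ∀ l ∈ S.erase j, (y + Pi.single j 1 : Fin d → ℝ) l = (y + Pi.single i 1 : Fin d → ℝ) l := by
        intro l hl
        have h1 : l ≠ j := Finset.ne_of_mem_erase hl
        have h2 : l ≠ i := fun e => hi (e ▸ hl)
        simp [h1, h2]
      rw [Finset.sum_congr rfl this]
      simpa using h
  · refine ⟨S, rfl, ?_⟩
    simp only [Pi.add_apply, Finset.sum_add_distrib, Finset.sum_pi_single']
    have : j ∈ S → i ∈ S := by tauto
    split_ifs <;> simp_all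

theorem sum_mul_nonneg_of_partial_sums_nonneg {g h : Fin d → ℝ} (hh : Antitone h)
    (hg : ∀ l, 0 ≤ ∑ i ∈ Finset.Iic l, g i) (hg0 : ∑ i, g i = 0) : 0 ≤ ∑ i, g i * h i := by
  -- Abel summation as an induction: the partial sum is nonnegative, so lowering its factor from `h
  -- m` to `h (m + 1)` only decreases the left side. At the last index the total is zero.
  have key : ∀ (m : ℕ) (hm : m < d), h ⟨m, hm⟩ * ∑ i ∈ Finset.Iic (⟨m, hm⟩ : Fin d), g i ≤
      ∑ i ∈ Finset.Iic (⟨m, hm⟩ : Fin d), g i * h i := by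
    intro m
    induction m with
    | zero =>
      intro hm
      have : Finset.Iic (⟨0, hm⟩ : Fin d) = {⟨0, hm⟩} := by
        ext i; simp [Fin.le_def, Fin.ext_iff]
      simp [this, mul_comm]
    | succ m ih =>
      intro hm
      have hm' : m < d := by omega
      have : Finset.Iic (⟨m + 1, hm⟩ : Fin d) = insert ⟨m + 1, hm⟩ (Finset.Iic ⟨m, hm'⟩) := by
        ext i; simp [Fin.le_def, Fin.ext_iff]; omega
      rw [this, Finset.sum_insert (by simp), Finset.sum_insert (by simp)]
      have h1 := mul_le_mul_of_nonneg_right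
        (hh (show (⟨m, hm'⟩ : Fin d) ≤ ⟨m + 1, hm⟩ by simp [Fin.le_def])) (hg ⟨m, hm'⟩)
      have h2 := ih hm'
      linarith
  rcases d with _ | m
  · simp
  · have h1 := key m (Nat.lt_succ_self m)
    have : Finset.Iic (⟨m, Nat.lt_succ_self m⟩ : Fin (m + 1)) = Finset.univ := by
      ext i; simpa [Fin.le_def] using Nat.le_of_lt_succ i.2
    rwa [this, hg0, mul_zero] at h1

end Majorization

/-! ### Configurations and Schur-convex functions -/

section Configurations

variable {n k : ℕ}

/-- Some set of colors as large as the support of `c'` carries all `n` nodes of `c`, hence contains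
the support of `c`. -/
theorem numColors_le_of_majorizes {c c' : Config n k} (h : Majorizes c.toReal c'.toReal) :
    c.numColors ≤ c'.numColors := by
  obtain ⟨T, hT, hT'⟩ := ((majorizes_iff _ _).1 h).1 (Finset.univ.filter fun i => c'.1 i ≠ 0)
  have hs : (∑ i, c'.1 i) ≤ ∑ i ∈ T, c.1 i := by
    rw [← Finset.sum_filter_ne_zero]
    simp only [Config.toReal] at hT'
    exact_mod_cast hT'
  replace hs := (c.2.trans c'.2.symm).le.trans hs
  refine le_trans (Finset.card_le_card fun i hi => ?_) hT.le
  by_contra hiT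
  have h1 : ∑ l ∈ insert i T, c.1 l ≤ ∑ l, c.1 l :=
    Finset.sum_le_sum_of_subset (Finset.subset_univ _)
  rw [Finset.sum_insert hiT] at h1
  have h2 : c.1 i ≠ 0 := (Finset.mem_filter.1 hi).2
  omega

theorem toReal_ofColoring_perm (x : Fin n → Fin k) (σ : Equiv.Perm (Fin k)) :
    (Config.ofColoring (σ ∘ x)).toReal = (Config.ofColoring x).toReal ∘ σ.symm := by
  funext i
  simp [Config.toReal, Config.ofColoring, Equiv.eq_symm_apply]

theorem toReal_ofColoring_update (x : Fin n → Fin k) (v : Fin n) (i : Fin k) :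
    (Config.ofColoring (Function.update x v i)).toReal =
      (fun l => (((Finset.univ.erase v).filter fun u => x u = l).card : ℝ)) + Pi.single i 1 := by
  funext l
  simp only [Config.toReal, Config.ofColoring, Pi.add_apply, Finset.card_filter]
  rw [← Finset.add_sum_erase _ _ (Finset.mem_univ v), add_comm]
  push_cast
  congr 1
  · refine Finset.sum_congr rfl fun u hu => ?_
    rw [Function.update_of_ne (Finset.ne_of_mem_erase hu)]
  · simp [Pi.single_apply, eq_comm]

/-- Monotonicity with respect to majorization of configurations. -/
def SchurConvex (f : Config n k → ℝ) : Prop :=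
  ∀ c c' : Config n k, Majorizes c.toReal c'.toReal → f c' ≤ f c

/-- A vector and its permutations majorize each other. -/
theorem SchurConvex.perm {f : Config n k → ℝ} (hf : SchurConvex f) (x : Fin n → Fin k)
    (σ : Equiv.Perm (Fin k)) : f (Config.ofColoring (σ ∘ x)) = f (Config.ofColoring x) := by
  have key : ∀ (x : Fin n → Fin k) (σ : Equiv.Perm (Fin k)),
      f (Config.ofColoring (σ ∘ x)) ≤ f (Config.ofColoring x) := fun x σ => hf _ _ <| by
    rw [toReal_ofColoring_perm]; exact majorizes_comp_perm _ _
  refine le_antisymm (key x σ) ?_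
  simpa [← Function.comp_assoc] using key (σ ∘ x) σ.symm

theorem SchurConvex.update_le {f : Config n k → ℝ} (hf : SchurConvex f) (x : Fin n → Fin k)
    (v : Fin n) {i j : Fin k} (h : ((Finset.univ.erase v).filter fun u => x u = j).card ≤
      ((Finset.univ.erase v).filter fun u => x u = i).card) :
    f (Config.ofColoring (Function.update x v j)) ≤
      f (Config.ofColoring (Function.update x v i)) := by
  apply hf
  rw [toReal_ofColoring_update, toReal_ofColoring_update]
  exact majorizes_add_single _ (by exact_mod_cast h)

end Configurations

end ACConsensus

namespace ACConsensus

/-! ### Product weights: color swaps, resampling, differentiation -/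

section Multinomial

variable {ι κ : Type*} [Fintype κ]

/-- The swap only exchanges the exponents of `r i` and `r j`; the larger base is better off with the
larger exponent. -/
theorem prod_swap_le_prod [DecidableEq κ] {s : Finset ι} {r : κ → ℝ} (hr : ∀ l, 0 ≤ r l) {i j : κ}
    (hij : r j ≤ r i) (x : ι → κ)
    (hx : (s.filter fun u => x u = j).card ≤ (s.filter fun u => x u = i).card) :
    ∏ u ∈ s, r (Equiv.swap i j (x u)) ≤ ∏ u ∈ s, r (x u) := by
  by_cases hne : i = j
  · simp [hne]
  have key : ∀ y : ι → κ, ∏ u ∈ s, r (y u) =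
      r i ^ (s.filter fun u => y u = i).card * (r j ^ (s.filter fun u => y u = j).card *
        ∏ l ∈ (Finset.univ.erase i).erase j, r l ^ (s.filter fun u => y u = l).card) := by
    intro y
    rw [← Finset.prod_fiberwise s y, ← Finset.mul_prod_erase _ _ (Finset.mem_univ i),
      ← Finset.mul_prod_erase _ _ (Finset.mem_erase.2 ⟨Ne.symm hne, Finset.mem_univ j⟩)]
    have h : ∀ l, ∏ u ∈ s with y u = l, r (y u) = r l ^ (s.filter fun u => y u = l).card := by
      intro l
      rw [Finset.prod_congr rfl fun u hu => by rw [(Finset.mem_filter.1 hu).2],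
        Finset.prod_const]
    simp only [h]
  rw [key x, key fun u => Equiv.swap i j (x u)]
  have h1 : ∀ u, Equiv.swap i j (x u) = i ↔ x u = j := fun u => by
    rw [Equiv.swap_apply_eq_iff, Equiv.swap_apply_left]
  have h2 : ∀ u, Equiv.swap i j (x u) = j ↔ x u = i := fun u => by
    rw [Equiv.swap_apply_eq_iff, Equiv.swap_apply_right]
  have h3 : ∏ l ∈ (Finset.univ.erase i).erase j,
      r l ^ (s.filter fun u => Equiv.swap i j (x u) = l).card =
      ∏ l ∈ (Finset.univ.erase i).erase j, r l ^ (s.filter fun u => x u = l).card := by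
    refine Finset.prod_congr rfl fun l hl => ?_
    simp only [Finset.mem_erase, Finset.mem_univ, and_true] at hl
    simp only [Equiv.swap_apply_eq_iff, Equiv.swap_apply_of_ne_of_ne hl.2 hl.1]
  simp only [h1, h2, h3]
  obtain ⟨m, hm⟩ := Nat.exists_eq_add_of_le hx
  set b := (s.filter fun u => x u = j).card
  rw [hm, ← mul_assoc, ← mul_assoc]
  refine mul_le_mul_of_nonneg_right ?_ (Finset.prod_nonneg fun l _ => pow_nonneg (hr l) _)
  calc r i ^ b * r j ^ (b + m) = (r i ^ b * r j ^ b) * r j ^ m := by ring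
    _ ≤ (r i ^ b * r j ^ b) * r i ^ m :=
      mul_le_mul_of_nonneg_left (pow_le_pow_left₀ (hr j) hij m)
        (mul_nonneg (pow_nonneg (hr i) _) (pow_nonneg (hr j) _))
    _ = r i ^ (b + m) * r j ^ b := by ring

variable [Fintype ι] [DecidableEq ι]

theorem card_mul_sum_eq_sum_update (v : ι) (G : (ι → κ) → ℝ) :
    (Fintype.card κ : ℝ) * ∑ x, G x = ∑ x, ∑ i, G (Function.update x v i) := by
  have h : ∑ p : (ι → κ) × κ, G (Function.update p.1 v p.2) = ∑ p : (ι → κ) × κ, G p.1 :=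
    Fintype.sum_equiv
      -- Exchanging the color of `v` with the spare color is an involution on pairs.
      (Function.Involutive.toPerm (fun p : (ι → κ) × κ => (Function.update p.1 v p.2, p.1 v))
        fun p => by simp) _ _ fun _ => rfl
  rw [Fintype.sum_prod_type, Fintype.sum_prod_type] at h
  rw [h]
  simp [Finset.mul_sum]

theorem hasDerivAt_sum_prod (F : (ι → κ) → ℝ) (q g : κ → ℝ) (t : ℝ) :
    HasDerivAt (fun t : ℝ => ∑ x : ι → κ, (∏ u, (q (x u) + t * g (x u))) * F x)
      (∑ x : ι → κ, (∑ v, (∏ u ∈ Finset.univ.erase v, (q (x u) + t * g (x u))) * g (x v)) * F x)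
      t := by
  refine HasDerivAt.fun_sum fun x _ => HasDerivAt.mul_const ?_ _
  refine HasDerivAt.fun_finsetProd fun u _ => ?_
  simpa using ((hasDerivAt_id t).mul_const (g (x u))).const_add (q (x u))

end Multinomial

/-! ### Schur convexity of multinomial means -/

section SchurConvex

variable {n k : ℕ}

/-- The expectation of `f` after all nodes independently chose colors according to `r`. -/
noncomputable def multinomialMean (f : Config n k → ℝ) (r : Fin k → ℝ) : ℝ :=
  ∑ x : Fin n → Fin k, (∏ u, r (x u)) * f (Config.ofColoring x)

theorem multinomialMean_comp_perm {f : Config n k → ℝ} (hf : SchurConvex f) (r : Fin k → ℝ)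
    (σ : Equiv.Perm (Fin k)) : multinomialMean f (r ∘ σ) = multinomialMean f r := by
  refine Fintype.sum_equiv (Equiv.arrowCongr (Equiv.refl (Fin n)) σ) _ _ fun x => ?_
  have : Equiv.arrowCongr (Equiv.refl (Fin n)) σ x = σ ∘ x := rfl
  rw [this, hf.perm]
  rfl

/-- Symmetrizing over the swap of `i` and `j` turns twice the difference of the two sides into a sum
of products `(A x - A (σ ∘ x)) * (F i x - F j x)`. Both factors take their sign from which of `i`,
`j` is more frequent among the nodes other than `v`. -/
theorem SchurConvex.sum_prod_erase_le {f : Config n k → ℝ} (hf : SchurConvex f) (v : Fin n)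
    {r : Fin k → ℝ} (hr : ∀ l, 0 ≤ r l) {i j : Fin k} (hij : r j ≤ r i) :
    ∑ x : Fin n → Fin k, (∏ u ∈ Finset.univ.erase v, r (x u)) *
        f (Config.ofColoring (Function.update x v j)) ≤
      ∑ x : Fin n → Fin k, (∏ u ∈ Finset.univ.erase v, r (x u)) *
        f (Config.ofColoring (Function.update x v i)) := by
  set A : (Fin n → Fin k) → ℝ := fun x => ∏ u ∈ Finset.univ.erase v, r (x u) with hA
  set F : Fin k → (Fin n → Fin k) → ℝ :=
    fun i x => f (Config.ofColoring (Function.update x v i)) with hF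
  set σ := Equiv.swap i j with hσ
  have hFj : ∀ x, F j (σ ∘ x) = F i x := by
    intro x
    simp only [hF]
    rw [← hf.perm (Function.update x v i) σ, Function.comp_update, hσ, Equiv.swap_apply_left]
  have hFi : ∀ x, F i (σ ∘ x) = F j x := by
    intro x
    simp only [hF]
    rw [← hf.perm (Function.update x v j) σ, Function.comp_update, hσ, Equiv.swap_apply_right]
  have hswap : ∀ G : (Fin n → Fin k) → ℝ, ∑ x, G (σ ∘ x) = ∑ x, G x := fun G =>
    Fintype.sum_equiv (Equiv.arrowCongr (Equiv.refl (Fin n)) σ) _ _ fun x => rfl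
  have h1 : ∑ x, A x * F j x = ∑ x, A (σ ∘ x) * F i x := by
    rw [← hswap]; simp only [hFj]
  have h2 : ∑ x, A x * F i x = ∑ x, A (σ ∘ x) * F j x := by
    rw [← hswap]; simp only [hFi]
  have h3 : 0 ≤ ∑ x, (A x - A (σ ∘ x)) * (F i x - F j x) := by
    refine Finset.sum_nonneg fun x _ => ?_
    rcases le_total ((Finset.univ.erase v).filter fun u => x u = j).card
      ((Finset.univ.erase v).filter fun u => x u = i).card with h | h
    · exact mul_nonneg (sub_nonneg.2 (prod_swap_le_prod hr hij x h))
        (sub_nonneg.2 (hf.update_le x v h))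
    · refine mul_nonneg_of_nonpos_of_nonpos (sub_nonpos.2 ?_)
        (sub_nonpos.2 (hf.update_le x v h))
      have := prod_swap_le_prod (s := Finset.univ.erase v) hr hij (σ ∘ x) (by
        simpa [hσ, Equiv.swap_apply_eq_iff] using h)
      simpa [hσ, hA] using this
  simp only [sub_mul, mul_sub, Finset.sum_sub_distrib] at h3
  linarith

theorem SchurConvex.deriv_multinomialMean_nonneg {f : Config n k → ℝ} (hf : SchurConvex f)
    {r g : Fin k → ℝ} (hr : ∀ l, 0 ≤ r l) (hr' : Antitone r)
    (hg : ∀ l, 0 ≤ ∑ i ∈ Finset.Iic l, g i) (hg0 : ∑ i, g i = 0) :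
    0 ≤ ∑ x : Fin n → Fin k, (∑ v, (∏ u ∈ Finset.univ.erase v, r (x u)) * g (x v)) *
      f (Config.ofColoring x) := by
  simp only [Finset.sum_mul]
  rw [Finset.sum_comm]
  refine Finset.sum_nonneg fun v _ => ?_
  -- Resampling the color of `v` multiplies the sum by `k`, so `k = 0` is split off.
  have hk : 0 < (Fintype.card (Fin k) : ℝ) ∨ IsEmpty (Fin k) := by
    rcases isEmpty_or_nonempty (Fin k) with h | h
    · exact Or.inr h
    · exact Or.inl (by exact_mod_cast Fintype.card_pos)
  rcases hk with hk | hk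
  · refine nonneg_of_mul_nonneg_right (a := (Fintype.card (Fin k) : ℝ)) ?_ hk
    rw [card_mul_sum_eq_sum_update v, Finset.sum_comm]
    have : ∀ (i : Fin k) (x : Fin n → Fin k),
        (∏ u ∈ Finset.univ.erase v, r (Function.update x v i u)) =
          ∏ u ∈ Finset.univ.erase v, r (x u) := fun i x =>
      Finset.prod_congr rfl fun u hu => by
        rw [Function.update_of_ne (Finset.ne_of_mem_erase hu)]
    simp only [this, Function.update_self, mul_assoc, mul_left_comm _ (g _), ← Finset.mul_sum]
    -- The contribution of `v` is now the pairing of `g` with the means given each color of `v`,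
    -- which are antitone in the color.
    exact sum_mul_nonneg_of_partial_sums_nonneg
      (fun i j hij => hf.sum_prod_erase_le v hr (hr' hij)) hg hg0
  · have : IsEmpty (Fin n → Fin k) := ⟨fun x => hk.false (x v)⟩
    simp

theorem SchurConvex.multinomialMean_le {f : Config n k → ℝ} (hf : SchurConvex f)
    {p q : Fin k → ℝ} (hp : ∀ l, 0 ≤ p l) (hq : ∀ l, 0 ≤ q l) (hpq : Majorizes p q) :
    multinomialMean f q ≤ multinomialMean f p := by
  have hsort : ∀ r, multinomialMean f r = multinomialMean f (sortDown r) := fun r =>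
    (multinomialMean_comp_perm hf r _).symm
  rw [hsort p, hsort q]
  -- The segment from sorted `q` to sorted `p` stays nonnegative and sorted; majorization says that
  -- its direction `g` has nonnegative partial sums.
  set g : Fin k → ℝ := fun i => sortDown p i - sortDown q i with hg
  have hd := hasDerivAt_sum_prod (fun x : Fin n → Fin k => f (Config.ofColoring x))
    (sortDown q) g
  have hmono := monotoneOn_of_deriv_nonneg (convex_Icc (0 : ℝ) 1)
    (fun t _ => (hd t).continuousAt.continuousWithinAt)
    (fun t _ => (hd t).differentiableAt.differentiableWithinAt)
    (fun t ht => by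
      rw [interior_Icc] at ht
      have hr : ∀ l, sortDown q l + t * g l = (1 - t) * sortDown q l + t * sortDown p l :=
        fun l => by simp only [hg]; ring
      rw [(hd t).deriv]
      refine hf.deriv_multinomialMean_nonneg (r := fun l => sortDown q l + t * g l)
        (fun l => ?_) (fun l m hlm => ?_) (fun l => ?_) ?_
      · rw [hr]
        exact add_nonneg (mul_nonneg (sub_nonneg.2 ht.2.le) (hq _)) (mul_nonneg ht.1.le (hp _))
      · simp only [hr]
        exact add_le_add
          (mul_le_mul_of_nonneg_left (sortDown_antitone q hlm) (sub_nonneg.2 ht.2.le))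
          (mul_le_mul_of_nonneg_left (sortDown_antitone p hlm) ht.1.le)
      · simpa [hg] using hpq.1 l
      · simp [hg, sum_sortDown, hpq.2])
  have h := hmono (Set.left_mem_Icc.2 zero_le_one) (Set.right_mem_Icc.2 zero_le_one) zero_le_one
  simpa [hg, multinomialMean] using h

end SchurConvex

end ACConsensus

namespace ACConsensus

/-! ### One-step comparison and survival probabilities -/

variable {n k : ℕ}

theorem ACProcess.integral_stepLaw (P : ACProcess n k) (c : Config n k) (f : Config n k → ℝ) :
    ∫ d, f d ∂P.stepLaw c = multinomialMean f (P.α c) := by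
  have hn : ∀ i, (P.nodeLaw c).real {i} = P.α c i := by
    intro i
    simp [nodeLaw, Measure.real, Measure.coe_finsetSum, Finset.sum_apply, Set.indicator,
      P.nonneg]
  have hm : Measurable (Config.ofColoring : (Fin n → Fin k) → Config n k) :=
    measurable_of_countable _
  unfold stepLaw multinomialMean
  rw [integral_map hm.aemeasurable (measurable_of_countable _).aestronglyMeasurable,
    integral_fintype Integrable.of_finite]
  refine Finset.sum_congr rfl fun x _ => ?_
  rw [Measure.real, Measure.pi_singleton, ENNReal.toReal_prod, smul_eq_mul]
  simp only [← measureReal_def, hn]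

theorem ACProcess.Dominates.lintegral_stepLaw_le {P P' : ACProcess n k} (h : P.Dominates P')
    {c c' : Config n k} (hc : Majorizes c.toReal c'.toReal) {f : Config n k → ENNReal}
    (hf : ∀ d d' : Config n k, Majorizes d.toReal d'.toReal → f d ≤ f d')
    (hf1 : ∀ d, f d ≤ 1) : ∫⁻ d, f d ∂P.stepLaw c ≤ ∫⁻ d, f d ∂P'.stepLaw c' := by
  have htop : ∀ d, f d ≠ ⊤ := fun d => ne_top_of_le_ne_top ENNReal.one_ne_top (hf1 d)
  have hfin : ∀ (Q : ACProcess n k) e, ∫⁻ d, f d ∂Q.stepLaw e ≠ ⊤ := fun Q e =>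
    ne_top_of_le_ne_top ENNReal.one_ne_top
      ((lintegral_mono hf1).trans (by simp))
  have hint : ∀ (Q : ACProcess n k) e,
      (∫⁻ d, f d ∂Q.stepLaw e).toReal = - multinomialMean (fun d => -(f d).toReal) (Q.α e) := by
    intro Q e
    rw [← integral_toReal (measurable_of_countable _).aemeasurable
      (Filter.Eventually.of_forall fun d => (htop d).lt_top), ← Q.integral_stepLaw, integral_neg,
      neg_neg]
  rw [← ENNReal.toReal_le_toReal (hfin _ _) (hfin _ _), hint, hint, neg_le_neg_iff]
  -- For `n = 0` the expected steps vanish and give no information on `α`, but then the mean does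
  -- not depend on the probability vector.
  rcases Nat.eq_zero_or_pos n with rfl | hn
  · have : ∀ r : Fin k → ℝ, multinomialMean (n := 0) (fun d => -(f d).toReal) r =
        ∑ x : Fin 0 → Fin k, -(f (Config.ofColoring x)).toReal := fun r => by
      simp [multinomialMean]
    rw [this, this]
  · refine SchurConvex.multinomialMean_le (fun d d' hd => ?_) (P.nonneg c) (P'.nonneg c') ?_
    · exact neg_le_neg (ENNReal.toReal_mono (htop _) (hf _ _ hd))
    · have := h c c' hc
      rw [funext (P.expectedStep_eq c), funext (P'.expectedStep_eq c')] at this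
      exact this.of_mul_left (by exact_mod_cast hn)

/-- The probability that the first `m` configurations of a run started in `c` all have more
than `κ` colors. -/
noncomputable def ACProcess.survivalProb (P : ACProcess n k) (κ : ℕ) :
    ℕ → Config n k → ENNReal
  | 0, _ => 1
  | m + 1, c => if κ < c.numColors then ∫⁻ d, P.survivalProb κ m d ∂P.stepLaw c else 0

theorem ACProcess.survivalProb_le_one (P : ACProcess n k) (κ m : ℕ) (c : Config n k) :
    P.survivalProb κ m c ≤ 1 := by
  induction m generalizing c with
  | zero => exact le_rfl
  | succ m ih =>
    rw [survivalProb]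
    split_ifs
    · exact (lintegral_mono ih).trans (by simp)
    · exact zero_le_one

theorem ACProcess.Dominates.survivalProb_le {P P' : ACProcess n k} (h : P.Dominates P')
    (κ m : ℕ) {c c' : Config n k} (hc : Majorizes c.toReal c'.toReal) :
    P.survivalProb κ m c ≤ P'.survivalProb κ m c' := by
  induction m generalizing c c' with
  | zero => exact le_rfl
  | succ m ih =>
    rw [survivalProb, survivalProb]
    split_ifs with h1 h2
    -- The least function above the survival probability of `P` that is antitone for majorization.
    -- The induction hypothesis over all comparable pairs bounds it by the survival probability of
    -- `P'`.
    · set f : Config n k → ENNReal :=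
        fun d => ⨆ (e : Config n k) (_ : Majorizes e.toReal d.toReal), P.survivalProb κ m e
      calc ∫⁻ d, P.survivalProb κ m d ∂P.stepLaw c ≤ ∫⁻ d, f d ∂P.stepLaw c :=
            lintegral_mono fun d => le_iSup₂_of_le d (Majorizes.refl _) le_rfl
        _ ≤ ∫⁻ d, f d ∂P'.stepLaw c' := h.lintegral_stepLaw_le hc
            (fun d d' hd => iSup₂_le fun e he => le_iSup₂_of_le e (he.trans hd) le_rfl)
            (fun d => iSup₂_le fun e _ => P.survivalProb_le_one κ m e)
        _ ≤ ∫⁻ d, P'.survivalProb κ m d ∂P'.stepLaw c' :=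
            lintegral_mono fun d => iSup₂_le fun e he => ih he
    · exact absurd (h1.trans_le (numColors_le_of_majorizes hc)) h2
    · exact zero_le
    · exact le_rfl

theorem natCast_le_reductionTime_iff {Ω : Type*} (X : ℕ → Ω → Config n k) (κ m : ℕ) (ω : Ω) :
    (m : ℕ∞) ≤ reductionTime X κ ω ↔ ∀ t < m, κ < (X t ω).numColors := by
  simp only [reductionTime, le_iInf_iff, Nat.cast_le]
  refine forall_congr' fun t => ?_
  rw [← not_imp_not, not_le, not_le]

/-! ### Runs realize the survival recursion -/

namespace ACProcess.IsRun

variable {P : ACProcess n k} {c : Config n k} {Ω : Type*} [MeasurableSpace Ω] {μ : Measure Ω}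
  {X : ℕ → Ω → Config n k}

/-- Conditioning on a whole history, at an arbitrary time `t`, lets the induction on `m` absorb the
next configuration into the history and apply `markov`. The window includes time `t`, so its first
condition concerns the known state `x t`. -/
theorem measure_history_inter_survival (hX : P.IsRun c μ X) (κ m t : ℕ) (x : ℕ → Config n k) :
    μ {ω | (∀ s ≤ t, X s ω = x s) ∧ ∀ s < m, κ < (X (t + s) ω).numColors} =
      μ {ω | ∀ s ≤ t, X s ω = x s} * P.survivalProb κ m (x t) := by
  induction m generalizing t x with
  | zero => simp [survivalProb]
  | succ m ih =>
    rw [survivalProb]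
    split_ifs with h
    · set y : Config n k → ℕ → Config n k := fun d => Function.update x (t + 1) d with hy
      have hyx : ∀ d, ∀ s ≤ t, y d s = x s := fun d s hs =>
        Function.update_of_ne (by omega) _ _
      have hyt : ∀ d, y d (t + 1) = d := fun d => Function.update_self _ _ _
      have hhist : ∀ d ω, (∀ s ≤ t + 1, X s ω = y d s) ↔
          (∀ s ≤ t, X s ω = x s) ∧ X (t + 1) ω = d := by
        intro d ω
        constructor
        · exact fun hs => ⟨fun s h' => (hs s (by omega)).trans (hyx d s h'),
            (hs _ le_rfl).trans (hyt d)⟩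
        · rintro ⟨h1, h2⟩ s hs
          rcases Nat.le_succ_iff.1 hs with h' | rfl
          · rw [h1 s h', hyx d s h']
          · rw [h2, hyt]
      -- Split according to the configuration `d` at time `t + 1`; there are countably many.
      have hunion : {ω | (∀ s ≤ t, X s ω = x s) ∧ ∀ s < m + 1, κ < (X (t + s) ω).numColors} =
          ⋃ d, {ω | (∀ s ≤ t + 1, X s ω = y d s) ∧
            ∀ s < m, κ < (X (t + 1 + s) ω).numColors} := by
        ext ω
        simp only [Set.mem_ofPred_eq, Set.mem_iUnion, hhist]
        constructor
        · rintro ⟨h1, h2⟩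
          refine ⟨X (t + 1) ω, ⟨h1, rfl⟩, fun s hs => ?_⟩
          rw [add_assoc, add_comm 1]
          exact h2 (s + 1) (by omega)
        · rintro ⟨d, ⟨h1, -⟩, h2⟩
          refine ⟨h1, fun s hs => ?_⟩
          rcases s with _ | s
          · rwa [add_zero, h1 t le_rfl]
          · rw [add_comm s, ← add_assoc]
            exact h2 s (by omega)
      have hdisj : Pairwise (Function.onFun Disjoint fun d =>
          {ω | (∀ s ≤ t + 1, X s ω = y d s) ∧ ∀ s < m, κ < (X (t + 1 + s) ω).numColors}) := by
        intro d e hde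
        refine Set.disjoint_left.2 fun ω h1 h2 => hde ?_
        exact ((hhist d ω).1 h1.1).2.symm.trans ((hhist e ω).1 h2.1).2
      have hmeas : ∀ d, MeasurableSet
          {ω | (∀ s ≤ t + 1, X s ω = y d s) ∧ ∀ s < m, κ < (X (t + 1 + s) ω).numColors} := by
        intro d
        have hE : ∀ s (p : Config n k → Prop), MeasurableSet {ω | p (X s ω)} := fun s p =>
          hX.measurable s (Set.to_countable {d | p d}).measurableSet
        simp only [Set.ofPred_and, Set.ofPred_forall]
        exact (MeasurableSet.iInter fun s => .iInter fun _ => hE s (· = y d s)).inter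
          (.iInter fun s => .iInter fun _ => hE (t + 1 + s) (κ < ·.numColors))
      have hpast : ∀ d, {ω | ∀ s ≤ t, X s ω = y d s} = {ω | ∀ s ≤ t, X s ω = x s} := by
        intro d
        ext ω
        exact forall₂_congr fun s hs => by rw [hyx d s hs]
      rw [hunion, measure_iUnion hdisj hmeas, lintegral_countable', ← ENNReal.tsum_mul_left]
      refine tsum_congr fun d => ?_
      rw [ih, hX.markov, hyt, hpast, hyx d t le_rfl, mul_assoc, mul_comm (P.stepLaw (x t) {d})]
    · rw [mul_zero]
      convert measure_empty (μ := μ)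
      ext ω
      simp only [Set.mem_ofPred_eq, Set.mem_empty_iff_false, iff_false]
      rintro ⟨h1, h2⟩
      have := h2 0 (Nat.succ_pos m)
      rw [add_zero, h1 t le_rfl] at this
      exact h this

theorem measure_le_reductionTime [IsProbabilityMeasure μ] (hX : P.IsRun c μ X) (κ m : ℕ) :
    μ {ω | (m : ℕ∞) ≤ reductionTime X κ ω} = P.survivalProb κ m c := by
  have h := hX.measure_history_inter_survival κ m 0 fun _ => c
  have h0 : μ {ω | ∀ s ≤ 0, X s ω = c} = 1 := by
    rw [← measure_univ (μ := μ)]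
    refine measure_congr ?_
    filter_upwards [hX.init] with ω hω
    exact eq_true fun s hs => by rwa [Nat.le_zero.1 hs]
  rw [h0, one_mul] at h
  rw [← h]
  refine measure_congr ?_
  filter_upwards [hX.init] with ω hω
  refine propext ((natCast_le_reductionTime_iff X κ m ω).trans ?_)
  simp only [zero_add]
  exact ⟨fun h' => ⟨fun s hs => by rwa [Nat.le_zero.1 hs], h'⟩, fun h' => h'.2⟩

end ACProcess.IsRun

end ACConsensus

theorem mainTheorem3 {n k : ℕ} (P P' : ACConsensus.ACProcess n k)
    (hdom : P.Dominates P') (c : ACConsensus.Config n k)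
    {Ω Ω' : Type*} [MeasurableSpace Ω] [MeasurableSpace Ω']
    (μ : Measure Ω) (μ' : Measure Ω') [IsProbabilityMeasure μ] [IsProbabilityMeasure μ']
    (X : ℕ → Ω → ACConsensus.Config n k) (X' : ℕ → Ω' → ACConsensus.Config n k)
    (hX : P.IsRun c μ X) (hX' : P'.IsRun c μ' X') (κ : ℕ) :
    ACConsensus.StochLE μ (ACConsensus.reductionTime X κ)
      μ' (ACConsensus.reductionTime X' κ) := by
  intro m
  rw [hX.measure_le_reductionTime, hX'.measure_le_reductionTime]
  exact hdom.survivalProb_le κ m (ACConsensus.Majorizes.refl _)
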